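/- Let $(M,g)$ be a compact smooth Riemannian manifold without boundary of dimension $n\ge 2$, with scalar curvature $R$. Let $X$ be a smooth vector field and $\rho:M\to\mathbb{R}$ a smooth function such that $(M,g,X,\rho)$ is an almost Yamabe soliton, i.e. $$\tfrac12\,\mathcal{L}_X g=(R-\rho)\,g ,$$ where $\mathcal{L}_X$ denotes the Lie derivative along $X$. If either $0\le\rho\le R$ everywhere on $M$, or $R\le\rho\le 0$ everywhere on $M$, then $X$ is a Killing vector field, i.e. $\mathcal{L}_X g=0$. -/

import Mathlib

open scoped Manifold ContDiff Bundle

namespace AlmostYamabe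

noncomputable section

/-! ### Scalar curvature of a metric given in coordinates -/

section Coordinates

variable {n : ℕ}

/-- The partial derivative `∂ᵢ f` of a function on `ℝⁿ` at `y`. -/
def pderiv (i : Fin n) (f : EuclideanSpace ℝ (Fin n) → ℝ) (y : EuclideanSpace ℝ (Fin n)) : ℝ :=
  fderiv ℝ f y (EuclideanSpace.single i 1)

/-- The Christoffel symbol `Γᵏᵢⱼ = ½ ∑ₗ Gᵏˡ (∂ᵢ Gⱼₗ + ∂ⱼ Gᵢₗ - ∂ₗ Gᵢⱼ)` of a metric with
coefficient matrix `G`. -/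
def christoffel (G : EuclideanSpace ℝ (Fin n) → Matrix (Fin n) (Fin n) ℝ) (k i j : Fin n)
    (y : EuclideanSpace ℝ (Fin n)) : ℝ :=
  (1 / 2) * ∑ l, (G y)⁻¹ k l *
    (pderiv i (fun z => G z j l) y + pderiv j (fun z => G z i l) y
      - pderiv l (fun z => G z i j) y)

/-- The Ricci tensor
`Ricⱼₖ = ∑ᵢ (∂ᵢ Γⁱⱼₖ - ∂ⱼ Γⁱᵢₖ) + ∑ᵢₗ (Γⁱᵢₗ Γˡⱼₖ - Γⁱⱼₗ Γˡᵢₖ)` of a metric with coefficient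
matrix `G` (sign convention: round spheres have positive Ricci curvature). -/
def ricci (G : EuclideanSpace ℝ (Fin n) → Matrix (Fin n) (Fin n) ℝ) (j k : Fin n)
    (y : EuclideanSpace ℝ (Fin n)) : ℝ :=
  (∑ i, (pderiv i (christoffel G i j k) y - pderiv j (christoffel G i i k) y))
    + ∑ i, ∑ l, (christoffel G i i l y * christoffel G l j k y
        - christoffel G i j l y * christoffel G l i k y)

/-- The scalar curvature `∑ⱼₖ Gʲᵏ Ricⱼₖ` of a metric with coefficient matrix `G`. -/
def coordScalarCurvature (G : EuclideanSpace ℝ (Fin n) → Matrix (Fin n) (Fin n) ℝ)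
    (y : EuclideanSpace ℝ (Fin n)) : ℝ :=
  ∑ j, ∑ k, (G y)⁻¹ j k * ricci G j k y

end Coordinates

/-! ### Riemannian manifolds, almost Yamabe solitons, Killing vector fields -/

section Manifold

variable {n : ℕ} {M : Type*} [TopologicalSpace M] [ChartedSpace (EuclideanSpace ℝ (Fin n)) M]
  [IsManifold (𝓡 n) ∞ M]

/-- The coefficients `Gᵢⱼ = g(∂ᵢ, ∂ⱼ)` of the Riemannian metric `g` in the preferred chart `φ`
around `p`, as functions on (the target of `φ` in) `ℝⁿ`; the coordinate vector field `∂ᵢ` is the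
image of the `i`-th standard basis vector under the differential of `φ⁻¹`. -/
def metricCoeff
    (g : Bundle.ContMDiffRiemannianMetric (𝓡 n) ∞ (EuclideanSpace ℝ (Fin n))
      (fun x : M => TangentSpace (𝓡 n) x))
    (p : M) (y : EuclideanSpace ℝ (Fin n)) : Matrix (Fin n) (Fin n) ℝ :=
  Matrix.of fun i j =>
    g.inner ((extChartAt (𝓡 n) p).symm y)
      (mfderiv 𝓘(ℝ, EuclideanSpace ℝ (Fin n)) (𝓡 n) (extChartAt (𝓡 n) p).symm y
        (EuclideanSpace.single i (1 : ℝ) : EuclideanSpace ℝ (Fin n)))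
      (mfderiv 𝓘(ℝ, EuclideanSpace ℝ (Fin n)) (𝓡 n) (extChartAt (𝓡 n) p).symm y
        (EuclideanSpace.single j (1 : ℝ) : EuclideanSpace ℝ (Fin n)))

/-- The scalar curvature `R` of `g` at `p`, computed in the preferred chart around `p` (the value
does not depend on the chart). -/
def scalarCurvature
    (g : Bundle.ContMDiffRiemannianMetric (𝓡 n) ∞ (EuclideanSpace ℝ (Fin n))
      (fun x : M => TangentSpace (𝓡 n) x))
    (p : M) : ℝ :=
  coordScalarCurvature (metricCoeff g p) (extChartAt (𝓡 n) p p)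

/-- A smooth vector field on `M`. -/
def IsSmoothVectorField (X : ∀ x : M, TangentSpace (𝓡 n) x) : Prop :=
  ContMDiff (𝓡 n) (𝓡 n).tangent ∞ (fun x => (⟨x, X x⟩ : TangentBundle (𝓡 n) M))

/-- The Lie derivative of the metric along `X`, evaluated on the vector fields `Y`, `Z`:
`(𝓛_X g)(Y, Z) = X (g(Y, Z)) - g([X, Y], Z) - g(Y, [X, Z])`. -/
def lieDerivMetric
    (g : Bundle.ContMDiffRiemannianMetric (𝓡 n) ∞ (EuclideanSpace ℝ (Fin n))
      (fun x : M => TangentSpace (𝓡 n) x))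
    (X Y Z : ∀ x : M, TangentSpace (𝓡 n) x) (p : M) : ℝ :=
  mvfderiv (𝓡 n) (fun x => g.inner x (Y x) (Z x)) p (X p)
    - g.inner p (VectorField.mlieBracket (𝓡 n) X Y p) (Z p)
    - g.inner p (Y p) (VectorField.mlieBracket (𝓡 n) X Z p)

/-- `(M, g, X, ρ)` is an almost Yamabe soliton: `X` and `ρ` are smooth and
`½ 𝓛_X g = (R - ρ) g`. -/
structure IsAlmostYamabeSoliton
    (g : Bundle.ContMDiffRiemannianMetric (𝓡 n) ∞ (EuclideanSpace ℝ (Fin n))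
      (fun x : M => TangentSpace (𝓡 n) x))
    (X : ∀ x : M, TangentSpace (𝓡 n) x) (ρ : M → ℝ) : Prop where
  smooth_X : IsSmoothVectorField X
  smooth_ρ : ContMDiff (𝓡 n) 𝓘(ℝ, ℝ) ∞ ρ
  eqn : ∀ Y Z : ∀ x : M, TangentSpace (𝓡 n) x,
    IsSmoothVectorField Y → IsSmoothVectorField Z → ∀ p : M,
      (1 / 2) * lieDerivMetric g X Y Z p
        = (scalarCurvature g p - ρ p) * g.inner p (Y p) (Z p)

/-- `X` is a Killing vector field of `g`: it is smooth and `𝓛_X g = 0`. -/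
structure IsKilling
    (g : Bundle.ContMDiffRiemannianMetric (𝓡 n) ∞ (EuclideanSpace ℝ (Fin n))
      (fun x : M => TangentSpace (𝓡 n) x))
    (X : ∀ x : M, TangentSpace (𝓡 n) x) : Prop where
  smooth_X : IsSmoothVectorField X
  lieDeriv_eq_zero : ∀ Y Z : ∀ x : M, TangentSpace (𝓡 n) x,
    IsSmoothVectorField Y → IsSmoothVectorField Z → ∀ p : M, lieDerivMetric g X Y Z p = 0

end Manifold

end

end AlmostYamabe

/-! Put `φ = R - ρ`. Tracing `½ 𝓛_X g = φ g` gives `div X = n φ`, and the divergence theorem on a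
closed manifold gives `∫ n φ = 0`. Either hypothesis gives `φ` a constant sign, so the continuous
function `φ` vanishes and `𝓛_X g = 0`.

Integration is done in charts with density `√(det G)`. Jacobi's formula turns the conformal equation
into `div(√(det G) X) = n φ √(det G)` (`divergence_coordField`). For `h` supported in one chart, the
Euclidean divergence theorem then yields `∫ (n φ h + X h) = 0` (`chartIntegral_divergence_eq_zero`).

Apply this to each member `ρᵢ` of a finite partition of unity and add. The terms `∫ X ρᵢ` live in
different charts; splitting each as `∑ⱼ ∫ ρⱼ X ρᵢ` and moving the summand from chart `i` to chart
`j` (`chartIntegral_eq_chartIntegral`) lets the sum over `i` be taken first, where `∑ᵢ X ρᵢ = X 1 =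
0`. Hence `∑ᵢ ∫ n φ ρᵢ = 0`, a sum of terms of one sign (`conformalFactor_eq_zero`). -/

open MeasureTheory Matrix

namespace AlmostYamabe

/-! ### Euclidean calculus: divergence theorem and derivative of the determinant -/

/-- A `C¹` vector field on an open set whose support is a compact subset of the set has total
divergence zero. -/
theorem setIntegral_divergence_eq_zero {n : ℕ}
    {U K : Set (EuclideanSpace ℝ (Fin n))} (hU : IsOpen U) (hK : IsCompact K) (hKU : K ⊆ U)
    {V : EuclideanSpace ℝ (Fin n) → EuclideanSpace ℝ (Fin n)} (hV : ContDiffOn ℝ 1 V U)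
    (hV0 : ∀ y ∈ U, y ∉ K → V y = 0) :
    ∫ y in U, ∑ k, fderiv ℝ V y (EuclideanSpace.single k 1) k = 0 := by
  -- Extension by zero stays `C¹`: `U` and the complement of `K` are open, cover the space, and `W`
  -- vanishes on the latter.
  set W : EuclideanSpace ℝ (Fin n) → EuclideanSpace ℝ (Fin n) := U.indicator V with hW
  have hWU : ∀ y ∈ U, W =ᶠ[nhds y] V := fun y hy => by
    filter_upwards [hU.mem_nhds hy] with z hz using Set.indicator_of_mem hz V
  have hW0 : ∀ y, y ∉ K → W y = 0 := fun y hy => by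
    by_cases h : y ∈ U
    · rw [hW, Set.indicator_of_mem h, hV0 y h hy]
    · exact Set.indicator_of_notMem h V
  have hWC : ContDiff ℝ 1 W := by
    rw [contDiff_iff_contDiffAt]
    intro y
    by_cases h : y ∈ U
    · exact ((hV y h).contDiffAt (hU.mem_nhds h)).congr_of_eventuallyEq (hWU y h)
    · have hy : y ∈ Kᶜ := fun h' => h (hKU h')
      refine (contDiffAt_const (c := (0 : EuclideanSpace ℝ (Fin n)))).congr_of_eventuallyEq ?_
      filter_upwards [hK.isClosed.isOpen_compl.mem_nhds hy] with z hz using hW0 z hz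
  have hWs : HasCompactSupport W := HasCompactSupport.intro hK hW0
  have hcomp : ∀ k y, fderiv ℝ (fun z => W z k) y (EuclideanSpace.single k 1)
      = fderiv ℝ W y (EuclideanSpace.single k 1) k := fun k y => by
    have := ((EuclideanSpace.proj (𝕜 := ℝ) k).hasFDerivAt.comp y
      (hWC.differentiable one_ne_zero y).hasFDerivAt).fderiv
    exact congrArg (fun L : EuclideanSpace ℝ (Fin n) →L[ℝ] ℝ =>
      L (EuclideanSpace.single k 1)) this
  have hdc : ∀ k, Continuous fun y => fderiv ℝ W y (EuclideanSpace.single k 1) k := fun k =>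
    (EuclideanSpace.proj (𝕜 := ℝ) k).continuous.comp
      ((hWC.continuous_fderiv one_ne_zero).clm_apply continuous_const)
  have hds : ∀ k, HasCompactSupport fun y => fderiv ℝ W y (EuclideanSpace.single k 1) k := fun k =>
    (hWs.fderiv (𝕜 := ℝ)).comp_left
      (g := fun L : EuclideanSpace ℝ (Fin n) →L[ℝ] EuclideanSpace ℝ (Fin n) =>
        L (EuclideanSpace.single k 1) k) (by simp)
  have hint : ∀ k, Integrable fun y => fderiv ℝ W y (EuclideanSpace.single k 1) k := fun k =>
    (hdc k).integrable_of_hasCompactSupport (hds k)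
  have hzero : ∀ k, ∫ y, fderiv ℝ W y (EuclideanSpace.single k 1) k = 0 := fun k => by
    have hWk : Continuous fun y => W y k :=
      (EuclideanSpace.proj (𝕜 := ℝ) k).continuous.comp hWC.continuous
    have hWks : HasCompactSupport fun y => W y k :=
      hWs.comp_left (g := fun v : EuclideanSpace ℝ (Fin n) => v k) (by simp)
    -- Integration by parts against the constant function `1`.
    have := integral_mul_fderiv_eq_neg_fderiv_mul_of_integrable (μ := volume)
      (f := fun _ : EuclideanSpace ℝ (Fin n) => (1 : ℝ)) (g := fun y => W y k)
      (v := EuclideanSpace.single k 1) (by simp) (by simpa [hcomp] using hint k)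
      (by simpa using hWk.integrable_of_hasCompactSupport hWks) (by simp)
      (fun y _ => (EuclideanSpace.proj (𝕜 := ℝ) k).differentiableAt.comp y
        (hWC.differentiable one_ne_zero y))
    simpa [hcomp] using this
  have hout : ∀ y, y ∉ U → fderiv ℝ W y = 0 := fun y hy => by
    by_contra hne
    have := (support_fderiv_subset ℝ) (Function.mem_support.2 hne)
    have hsub : Function.support W ⊆ K := fun z hz => by_contra fun h => hz (hW0 z h)
    exact hy (hKU (closure_minimal hsub hK.isClosed this))
  calc ∫ y in U, ∑ k, fderiv ℝ V y (EuclideanSpace.single k 1) k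
      = ∫ y in U, ∑ k, fderiv ℝ W y (EuclideanSpace.single k 1) k :=
        setIntegral_congr_fun hU.measurableSet fun y hy => by
          simp only [(hWU y hy).fderiv_eq]
    _ = ∫ y, ∑ k, fderiv ℝ W y (EuclideanSpace.single k 1) k :=
        setIntegral_eq_integral_of_forall_compl_eq_zero fun y hy => by simp [hout y hy]
    _ = 0 := by
        rw [integral_finsetSum _ fun k _ => hint k]
        exact Finset.sum_eq_zero fun k _ => hzero k

theorem contDiffOn_det {n : ℕ} {m : WithTop ℕ∞} {F : Type*} [NormedAddCommGroup F] [NormedSpace ℝ F]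
    {s : Set F} {G : F → Matrix (Fin n) (Fin n) ℝ}
    (hG : ∀ i j, ContDiffOn ℝ m (fun y => G y i j) s) :
    ContDiffOn ℝ m (fun y => (G y).det) s := by
  simp only [Matrix.det_apply]
  refine ContDiffOn.sum fun σ _ => ContDiffOn.const_smul _ ?_
  exact contDiffOn_prod fun i _ => hG _ _

/-- **Jacobi's formula**. -/
theorem fderiv_det_apply {n : ℕ} {F : Type*} [NormedAddCommGroup F] [NormedSpace ℝ F]
    {G : F → Matrix (Fin n) (Fin n) ℝ} {y : F}
    (hG : ∀ i j, DifferentiableAt ℝ (fun z => G z i j) y) (v : F) :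
    fderiv ℝ (fun z => (G z).det) y v
      = ((G y).adjugate * Matrix.of fun i j => fderiv ℝ (fun z => G z i j) y v).trace := by
  set H : Matrix (Fin n) (Fin n) ℝ := Matrix.of fun i j => fderiv ℝ (fun z => G z i j) y v with hH
  have h1 : HasFDerivAt (fun z => (G z).det) (∑ σ : Equiv.Perm (Fin n), Equiv.Perm.sign σ •
      ∑ i, (∏ j ∈ Finset.univ.erase i, G y (σ j) j) • fderiv ℝ (fun z => G z (σ i) i) y) y := by
    simp only [Matrix.det_apply]
    exact HasFDerivAt.fun_sum fun σ _ => (HasFDerivAt.finsetProd fun i _ =>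
      (hG (σ i) i).hasFDerivAt).const_smul _
  -- Cramer's rule: a diagonal entry is the determinant with one column differentiated, which is one
  -- summand of the product rule applied to the Leibniz expansion.
  have h2 : ∀ i, ((G y).adjugate * H) i i = ((G y).updateCol i fun k => H k i).det := fun i => by
    rw [← Matrix.cramer_apply, Matrix.cramer_eq_adjugate_mulVec]
    rfl
  have h3 : ∀ (i : Fin n) (σ : Equiv.Perm (Fin n)),
      ∏ j, (G y).updateCol i (fun k => H k i) (σ j) j
        = (∏ j ∈ Finset.univ.erase i, G y (σ j) j) * H (σ i) i := fun i σ => by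
    rw [← Finset.prod_erase_mul _ _ (Finset.mem_univ i), Matrix.updateCol_self]
    congr 1
    exact Finset.prod_congr rfl fun j hj => Matrix.updateCol_ne (Finset.ne_of_mem_erase hj)
  rw [h1.fderiv, Matrix.trace]
  simp only [Matrix.diag_apply, h2, Matrix.det_apply, h3]
  rw [Finset.sum_comm]
  simp only [_root_.sum_apply, _root_.smul_apply, smul_eq_mul,
    Finset.smul_sum, hH, Matrix.of_apply]

/-- If the metric with coefficient matrix `G` satisfies `𝓛_X G = 2 c G` at a point, then the
divergence of `√(det G) X` there is `n c √(det G)`. -/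
theorem fderiv_sqrt_det_of_conformal {n : ℕ} {F : Type*} [NormedAddCommGroup F] [NormedSpace ℝ F]
    {G : F → Matrix (Fin n) (Fin n) ℝ} {y : F}
    (hG : ∀ i j, DifferentiableAt ℝ (fun z => G z i j) y) (hdet : 0 < (G y).det) (v : F)
    (A : Matrix (Fin n) (Fin n) ℝ) (c : ℝ)
    (hc : (Matrix.of fun i j => fderiv ℝ (fun z => G z i j) y v) + Aᵀ * G y + G y * A
      = (2 * c) • G y) :
    fderiv ℝ (fun z => √(G z).det) y v + √(G y).det * A.trace = n * c * √(G y).det := by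
  have hd : DifferentiableAt ℝ (fun z => (G z).det) y := by
    simp only [Matrix.det_apply]
    exact DifferentiableAt.fun_sum fun σ _ => (HasFDerivAt.finsetProd fun i _ =>
      (hG (σ i) i).hasFDerivAt).differentiableAt.const_smul _
  have h1 := fderiv_det_apply hG v
  have h2 : (Matrix.of fun i j => fderiv ℝ (fun z => G z i j) y v)
      = (2 * c) • G y - Aᵀ * G y - G y * A := by rw [← hc]; abel
  -- Traced against the adjugate, each `A` term contributes `det G · tr A` and the conformal term `2
  -- n c det G`. Thus `d(det G)(v) = 2 (n c - tr A) det G`, and the square root halves the factor.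
  have h3 : ((G y).adjugate * (Aᵀ * G y)).trace = (G y).det * A.trace := by
    rw [Matrix.trace_mul_comm, Matrix.mul_assoc, Matrix.mul_adjugate, Matrix.mul_smul,
      Matrix.mul_one, Matrix.trace_smul, Matrix.trace_transpose, smul_eq_mul]
  have h4 : ((G y).adjugate * (G y * A)).trace = (G y).det * A.trace := by
    rw [← Matrix.mul_assoc, Matrix.adjugate_mul, Matrix.smul_mul, Matrix.one_mul,
      Matrix.trace_smul, smul_eq_mul]
  have h5 : ((G y).adjugate * ((2 * c) • G y)).trace = 2 * c * ((G y).det * n) := by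
    rw [Matrix.mul_smul, Matrix.adjugate_mul, Matrix.trace_smul, Matrix.trace_smul,
      Matrix.trace_one, smul_eq_mul, smul_eq_mul, Fintype.card_fin]
  rw [h2, Matrix.mul_sub, Matrix.mul_sub, Matrix.trace_sub, Matrix.trace_sub, h3, h4, h5] at h1
  rw [fderiv_sqrt hd hdet.ne', _root_.smul_apply, h1, smul_eq_mul]
  have hs : √(G y).det ≠ 0 := (Real.sqrt_pos.2 hdet).ne'
  have hs2 : √(G y).det * √(G y).det = (G y).det := Real.mul_self_sqrt hdet.le
  generalize √(G y).det = s at *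
  rw [← hs2]
  field_simp
  ring

/-! ### Vector fields and the metric in a chart -/

variable {n : ℕ} {M : Type*} [TopologicalSpace M] [ChartedSpace (EuclideanSpace ℝ (Fin n)) M]

theorem mvfderiv_eq_zero_of_notMem_tsupport {h : M → ℝ} {x : M} (hx : x ∉ tsupport h)
    (v : TangentSpace (𝓡 n) x) : mvfderiv (𝓡 n) h x v = 0 := by
  have h1 : h =ᶠ[nhds x] fun _ => 0 := notMem_tsupport_iff_eventuallyEq.1 hx
  have h2 : mvfderiv (𝓡 n) h x = mvfderiv (𝓡 n) (fun _ : M => (0 : ℝ)) x := by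
    unfold mvfderiv
    rw [h1.mfderiv_eq, h1.self_of_nhds]
  rw [h2, mvfderiv_const]
  rfl

variable [IsManifold (𝓡 n) ∞ M]

/-- The coordinate expression of a vector field in the preferred chart around `p`. -/
noncomputable def coordField (X : ∀ x : M, TangentSpace (𝓡 n) x) (p : M)
    (y : EuclideanSpace ℝ (Fin n)) : EuclideanSpace ℝ (Fin n) :=
  VectorField.mpullback 𝓘(ℝ, EuclideanSpace ℝ (Fin n)) (𝓡 n) (extChartAt (𝓡 n) p).symm X y

/-- The Riemannian volume density `√(det G)` in the preferred chart around `p`. -/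
noncomputable def volumeDensity
    (g : Bundle.ContMDiffRiemannianMetric (𝓡 n) ∞ (EuclideanSpace ℝ (Fin n))
      (fun x : M => TangentSpace (𝓡 n) x)) (p : M) (y : EuclideanSpace ℝ (Fin n)) : ℝ :=
  √(metricCoeff g p y).det

theorem contMDiffAt_extChartAt_symm {p : M} {y : EuclideanSpace ℝ (Fin n)}
    (hy : y ∈ (extChartAt (𝓡 n) p).target) :
    ContMDiffAt 𝓘(ℝ, EuclideanSpace ℝ (Fin n)) (𝓡 n) ∞ (extChartAt (𝓡 n) p).symm y :=
  (contMDiffOn_extChartAt_symm p).contMDiffAt ((isOpen_extChartAt_target p).mem_nhds hy)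

theorem isInvertible_mfderiv_extChartAt_symm
    {p : M} {y : EuclideanSpace ℝ (Fin n)}
    (hy : y ∈ (extChartAt (𝓡 n) p).target) :
    (mfderiv 𝓘(ℝ, EuclideanSpace ℝ (Fin n)) (𝓡 n) (extChartAt (𝓡 n) p).symm y).IsInvertible := by
  have := isInvertible_mfderivWithin_extChartAt_symm (I := 𝓡 n) hy
  rwa [ModelWithCorners.range_eq_univ, mfderivWithin_univ] at this

/-- The pullback uses `ContinuousLinearMap.inverse`, a genuine inverse only where the differential
is invertible, hence the restriction on `y`. -/
theorem mfderiv_coordField (X : ∀ x : M, TangentSpace (𝓡 n) x) {p : M}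
    {y : EuclideanSpace ℝ (Fin n)} (hy : y ∈ (extChartAt (𝓡 n) p).target) :
    mfderiv 𝓘(ℝ, EuclideanSpace ℝ (Fin n)) (𝓡 n) (extChartAt (𝓡 n) p).symm y (coordField X p y)
      = X ((extChartAt (𝓡 n) p).symm y) :=
  (isInvertible_mfderiv_extChartAt_symm hy).self_apply_inverse _

theorem contDiffOn_coordField {X : ∀ x : M, TangentSpace (𝓡 n) x}
    (hX : IsSmoothVectorField X) (p : M) :
    ContDiffOn ℝ ∞ (coordField X p) (extChartAt (𝓡 n) p).target := fun y hy => by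
  have h := ContMDiffAt.mpullback_vectorField_preimage (m := ∞) (n := ∞) (hX _)
    (contMDiffAt_extChartAt_symm hy) (isInvertible_mfderiv_extChartAt_symm hy) (by simp)
  have h2 := contMDiffAt_vectorSpace_iff_contDiffAt.1 h
  exact h2.contDiffWithinAt

/-- Fields along a map `b` cover both uses: the coordinate frame over a chart target, and vector
fields on `M` itself with `b` the identity. -/
theorem contMDiffWithinAt_inner {F H N : Type*} [NormedAddCommGroup F] [NormedSpace ℝ F]
    [TopologicalSpace H] {J : ModelWithCorners ℝ F H} [TopologicalSpace N] [ChartedSpace H N]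
    (g : Bundle.ContMDiffRiemannianMetric (𝓡 n) ∞ (EuclideanSpace ℝ (Fin n))
      (fun x : M => TangentSpace (𝓡 n) x)) {b : N → M} {s : Set N} {q : N}
    {v w : ∀ z, TangentSpace (𝓡 n) (b z)}
    (hv : ContMDiffWithinAt J (𝓡 n).tangent ∞ (fun z => (⟨b z, v z⟩ : TangentBundle (𝓡 n) M)) s q)
    (hw : ContMDiffWithinAt J (𝓡 n).tangent ∞ (fun z => (⟨b z, w z⟩ : TangentBundle (𝓡 n) M)) s q)
    (hb : ContMDiffWithinAt J (𝓡 n) ∞ b s q) :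
    ContMDiffWithinAt J 𝓘(ℝ) ∞ (fun z => g.inner (b z) (v z) (w z)) s q := by
  have : ContMDiffWithinAt J ((𝓡 n).prod 𝓘(ℝ)) ∞
      (fun z => Bundle.TotalSpace.mk' ℝ (E := Bundle.Trivial M ℝ) (b z)
        (g.inner (b z) (v z) (w z))) s q :=
    ContMDiffWithinAt.clm_bundle_apply₂ (F₁ := EuclideanSpace ℝ (Fin n))
      (F₂ := EuclideanSpace ℝ (Fin n)) (E₁ := fun x : M => TangentSpace (𝓡 n) x)
      (E₂ := fun x : M => TangentSpace (𝓡 n) x) (E₃ := Bundle.Trivial M ℝ)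
      (b := b) (ψ := fun z => g.inner (b z))
      (ContMDiffAt.comp_contMDiffWithinAt q g.contMDiff.contMDiffAt hb) hv hw
  exact (Bundle.contMDiffWithinAt_totalSpace.1 this).2

theorem contDiffOn_metricCoeff
    (g : Bundle.ContMDiffRiemannianMetric (𝓡 n) ∞ (EuclideanSpace ℝ (Fin n))
      (fun x : M => TangentSpace (𝓡 n) x)) (p : M) (i j : Fin n) :
    ContDiffOn ℝ ∞ (fun y => metricCoeff g p y i j) (extChartAt (𝓡 n) p).target := by
  have hU : IsOpen (extChartAt (𝓡 n) p).target := isOpen_extChartAt_target p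
  have hE : ∀ i : Fin n, ContMDiffOn 𝓘(ℝ, EuclideanSpace ℝ (Fin n)) (𝓡 n).tangent ∞
      (fun y => (⟨(extChartAt (𝓡 n) p).symm y,
        mfderiv 𝓘(ℝ, EuclideanSpace ℝ (Fin n)) (𝓡 n) (extChartAt (𝓡 n) p).symm y
        (EuclideanSpace.single i (1 : ℝ) : EuclideanSpace ℝ (Fin n))⟩ : TangentBundle (𝓡 n) M))
      (extChartAt (𝓡 n) p).target := fun i => by
    -- The coordinate frame is the tangent map of the inverse chart applied to a constant section.
    have h1 := (contMDiffOn_extChartAt_symm (I := 𝓡 n) (n := ∞) p).contMDiffOn_tangentMapWithin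
      (m := ∞) (by simp) hU.uniqueMDiffOn
    have h2 : ContMDiffOn 𝓘(ℝ, EuclideanSpace ℝ (Fin n)) 𝓘(ℝ, EuclideanSpace ℝ (Fin n)).tangent ∞
        (fun y => (⟨y, EuclideanSpace.single i (1 : ℝ)⟩ :
          TangentBundle 𝓘(ℝ, EuclideanSpace ℝ (Fin n)) (EuclideanSpace ℝ (Fin n))))
        (extChartAt (𝓡 n) p).target :=
      contMDiffOn_vectorSpace_iff_contDiffOn.2 contDiffOn_const
    refine (h1.comp h2 fun y hy => hy).congr fun y hy => ?_
    simp only [Function.comp, tangentMapWithin, mfderivWithin_of_isOpen hU hy]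
  exact fun y hy => (contMDiffWithinAt_inner g (hE i y hy) (hE j y hy)
    (contMDiffAt_extChartAt_symm hy).contMDiffWithinAt).contDiffWithinAt

theorem inner_mfderiv_eq_sum
    (g : Bundle.ContMDiffRiemannianMetric (𝓡 n) ∞ (EuclideanSpace ℝ (Fin n))
      (fun x : M => TangentSpace (𝓡 n) x)) (p : M) (y u v : EuclideanSpace ℝ (Fin n)) :
    g.inner ((extChartAt (𝓡 n) p).symm y)
      (mfderiv 𝓘(ℝ, EuclideanSpace ℝ (Fin n)) (𝓡 n) (extChartAt (𝓡 n) p).symm y u)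
      (mfderiv 𝓘(ℝ, EuclideanSpace ℝ (Fin n)) (𝓡 n) (extChartAt (𝓡 n) p).symm y v)
      = ∑ i, ∑ j, metricCoeff g p y i j * u i * v j := by
  set L : EuclideanSpace ℝ (Fin n) →L[ℝ] TangentSpace (𝓡 n) ((extChartAt (𝓡 n) p).symm y) :=
    mfderiv 𝓘(ℝ, EuclideanSpace ℝ (Fin n)) (𝓡 n) (extChartAt (𝓡 n) p).symm y with hL
  have h : ∀ w : EuclideanSpace ℝ (Fin n), L w = ∑ i, w i • L (EuclideanSpace.single i 1) :=
    fun w => by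
    have hw : w = ∑ i, w i • EuclideanSpace.single i (1 : ℝ) := by
      simpa using ((EuclideanSpace.basisFun (Fin n) ℝ).sum_repr w).symm
    calc L w = L (∑ i, w i • EuclideanSpace.single i (1 : ℝ)) := congrArg L hw
      _ = _ := by rw [map_sum]; exact Finset.sum_congr rfl fun i _ => map_smul L _ _
  have hm : ∀ i j, metricCoeff g p y i j = g.inner ((extChartAt (𝓡 n) p).symm y)
      (L (EuclideanSpace.single i 1)) (L (EuclideanSpace.single j 1)) := fun i j => rfl
  change g.inner _ (L u) (L v) = _
  rw [h u, h v]
  simp only [map_sum, map_smul, _root_.sum_apply, _root_.smul_apply, smul_eq_mul, hm,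
    Finset.mul_sum]
  rw [Finset.sum_comm]
  exact Finset.sum_congr rfl fun i _ => Finset.sum_congr rfl fun j _ => by ring

theorem metricCoeff_symm
    (g : Bundle.ContMDiffRiemannianMetric (𝓡 n) ∞ (EuclideanSpace ℝ (Fin n))
      (fun x : M => TangentSpace (𝓡 n) x)) (p : M) (y : EuclideanSpace ℝ (Fin n)) (i j : Fin n) :
    metricCoeff g p y i j = metricCoeff g p y j i :=
  g.symm _ _ _

theorem det_metricCoeff_pos
    (g : Bundle.ContMDiffRiemannianMetric (𝓡 n) ∞ (EuclideanSpace ℝ (Fin n))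
      (fun x : M => TangentSpace (𝓡 n) x)) {p : M} {y : EuclideanSpace ℝ (Fin n)}
    (hy : y ∈ (extChartAt (𝓡 n) p).target) : 0 < (metricCoeff g p y).det := by
  refine Matrix.PosDef.det_pos (Matrix.PosDef.of_dotProduct_mulVec_pos ?_ fun x hx => ?_)
  · ext i j
    exact metricCoeff_symm g p y j i
  · have h := inner_mfderiv_eq_sum g p y (WithLp.toLp 2 x) (WithLp.toLp 2 x)
    have hne : mfderiv 𝓘(ℝ, EuclideanSpace ℝ (Fin n)) (𝓡 n) (extChartAt (𝓡 n) p).symm y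
        (WithLp.toLp 2 x : EuclideanSpace ℝ (Fin n)) ≠ 0 := fun h0 => hx <| by
      have := (isInvertible_mfderiv_extChartAt_symm hy).injective (h0.trans (map_zero _).symm)
      exact congrArg WithLp.ofLp this
    have hpos := g.pos _ _ hne
    rw [h] at hpos
    refine lt_of_lt_of_eq hpos ?_
    simp only [dotProduct, mulVec, Pi.star_apply, star_trivial, Finset.mul_sum]
    exact Finset.sum_congr rfl fun i _ => Finset.sum_congr rfl fun j _ => by ring

theorem contDiffOn_volumeDensity
    (g : Bundle.ContMDiffRiemannianMetric (𝓡 n) ∞ (EuclideanSpace ℝ (Fin n))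
      (fun x : M => TangentSpace (𝓡 n) x)) (p : M) :
    ContDiffOn ℝ ∞ (volumeDensity g p) (extChartAt (𝓡 n) p).target :=
  (contDiffOn_det (contDiffOn_metricCoeff g p)).sqrt fun _ hy => (det_metricCoeff_pos g hy).ne'

theorem volumeDensity_pos
    (g : Bundle.ContMDiffRiemannianMetric (𝓡 n) ∞ (EuclideanSpace ℝ (Fin n))
      (fun x : M => TangentSpace (𝓡 n) x)) {p : M} {y : EuclideanSpace ℝ (Fin n)}
    (hy : y ∈ (extChartAt (𝓡 n) p).target) : 0 < volumeDensity g p y :=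
  Real.sqrt_pos.2 (det_metricCoeff_pos g hy)

/-- The conformal equation is assumed for global smooth fields only; a local extension cut off by a
bump function allows testing it on any tangent vector. -/
theorem exists_isSmoothVectorField_eq [T2Space M] (q : M) (v : TangentSpace (𝓡 n) q) :
    ∃ Y : ∀ x : M, TangentSpace (𝓡 n) x, IsSmoothVectorField Y ∧ Y q = v := by
  obtain ⟨s, hs, hsm⟩ := FiberBundle.exists_contMDiffOn_extend (k := ∞) (𝓡 n)
    (EuclideanSpace ℝ (Fin n)) (V := fun x : M => TangentSpace (𝓡 n) x) v
  obtain ⟨u, hus, hu, hqu⟩ := mem_nhds_iff.1 hs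
  obtain ⟨f, -, hf⟩ := (SmoothBumpFunction.nhds_basis_tsupport (I := 𝓡 n) q).mem_iff.1
    (hu.mem_nhds hqu)
  refine ⟨fun x => f x • FiberBundle.extend (EuclideanSpace ℝ (Fin n)) v x,
    ContMDiffOn.smul_section_of_tsupport f.contMDiff.contMDiffOn hu hf (hsm.mono hus), ?_⟩
  simp

/-! ### The Lie derivative of the metric and the divergence in coordinates -/

theorem mvfderiv_eq_fderiv_comp (X : ∀ x : M, TangentSpace (𝓡 n) x) {p : M}
    {y : EuclideanSpace ℝ (Fin n)} (hy : y ∈ (extChartAt (𝓡 n) p).target) {h : M → ℝ}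
    (hh : MDifferentiableAt (𝓡 n) 𝓘(ℝ) h ((extChartAt (𝓡 n) p).symm y)) :
    mvfderiv (𝓡 n) h ((extChartAt (𝓡 n) p).symm y) (X ((extChartAt (𝓡 n) p).symm y))
      = fderiv ℝ (fun z => h ((extChartAt (𝓡 n) p).symm z)) y (coordField X p y) := by
  have h1 := mfderiv_comp y hh ((contMDiffAt_extChartAt_symm hy).mdifferentiableAt (by simp))
  rw [mfderiv_eq_fderiv] at h1
  have h2 := congrArg (fun L : EuclideanSpace ℝ (Fin n) →L[ℝ] ℝ => L (coordField X p y)) h1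
  refine Eq.trans ?_ h2.symm
  rw [← mfderiv_coordField X hy]
  rfl

/-- The bracket is natural under pullback by the inverse chart, and on a vector space it is the
difference of directional derivatives. -/
theorem mlieBracket_eq_mfderiv_lieBracket {X Y : ∀ x : M, TangentSpace (𝓡 n) x}
    (hX : IsSmoothVectorField X) (hY : IsSmoothVectorField Y) {p : M}
    {y : EuclideanSpace ℝ (Fin n)} (hy : y ∈ (extChartAt (𝓡 n) p).target) :
    VectorField.mlieBracket (𝓡 n) X Y ((extChartAt (𝓡 n) p).symm y)
      = mfderiv 𝓘(ℝ, EuclideanSpace ℝ (Fin n)) (𝓡 n) (extChartAt (𝓡 n) p).symm y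
        (fderiv ℝ (coordField Y p) y (coordField X p y)
          - fderiv ℝ (coordField X p) y (coordField Y p y) : EuclideanSpace ℝ (Fin n)) := by
  have : IsManifold (𝓡 n) (minSmoothness ℝ 2) M := by
    rw [minSmoothness_of_isRCLikeNormedField]; infer_instance
  have : IsManifold 𝓘(ℝ, EuclideanSpace ℝ (Fin n)) (minSmoothness ℝ 2)
      (EuclideanSpace ℝ (Fin n)) := by
    rw [minSmoothness_of_isRCLikeNormedField]; infer_instance
  have h := VectorField.mpullback_mlieBracket (n := ∞) (I := 𝓘(ℝ, EuclideanSpace ℝ (Fin n)))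
    ((hX _).mdifferentiableAt (by simp)) ((hY _).mdifferentiableAt (by simp))
    (contMDiffAt_extChartAt_symm hy)
    (by rw [minSmoothness_of_isRCLikeNormedField]; exact ENat.LEInfty.out)
  rw [← mfderiv_coordField (VectorField.mlieBracket (𝓡 n) X Y) hy]
  congr 1
  refine h.trans ?_
  have h2 := congrFun (VectorField.mlieBracketWithin_eq_lieBracketWithin (𝕜 := ℝ)
    (V := coordField X p) (W := coordField Y p) (s := Set.univ)) y
  exact (congrFun VectorField.mlieBracketWithin_univ y).symm.trans
    (h2.trans (congrFun VectorField.lieBracketWithin_univ y))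

/-- The derivatives of `Y` and `Z` from the Leibniz rule cancel against the brackets, so only their
values at the point remain. -/
theorem lieDerivMetric_eq_sum
    (g : Bundle.ContMDiffRiemannianMetric (𝓡 n) ∞ (EuclideanSpace ℝ (Fin n))
      (fun x : M => TangentSpace (𝓡 n) x)) {X Y Z : ∀ x : M, TangentSpace (𝓡 n) x}
    (hX : IsSmoothVectorField X) (hY : IsSmoothVectorField Y) (hZ : IsSmoothVectorField Z) {p : M}
    {y : EuclideanSpace ℝ (Fin n)} (hy : y ∈ (extChartAt (𝓡 n) p).target) :
    lieDerivMetric g X Y Z ((extChartAt (𝓡 n) p).symm y) = ∑ i, ∑ j,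
      (fderiv ℝ (fun z => metricCoeff g p z i j) y (coordField X p y)
          * coordField Y p y i * coordField Z p y j
        + metricCoeff g p y i j * fderiv ℝ (coordField X p) y (coordField Y p y) i
          * coordField Z p y j
        + metricCoeff g p y i j * coordField Y p y i
          * fderiv ℝ (coordField X p) y (coordField Z p y) j) := by
  have hU := (isOpen_extChartAt_target (I := 𝓡 n) p).mem_nhds hy
  have hdiff : ∀ {W : ∀ x : M, TangentSpace (𝓡 n) x}, IsSmoothVectorField W →
      DifferentiableAt ℝ (coordField W p) y := fun hW =>
    ((contDiffOn_coordField hW p).contDiffAt hU).differentiableAt (by simp)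
  have hcomp : ∀ {W : ∀ x : M, TangentSpace (𝓡 n) x}, IsSmoothVectorField W → ∀ i,
      HasFDerivAt (fun z => coordField W p z i)
        ((EuclideanSpace.proj (𝕜 := ℝ) i).comp (fderiv ℝ (coordField W p) y)) y := fun hW i =>
    (EuclideanSpace.proj (𝕜 := ℝ) i).hasFDerivAt.comp y (hdiff hW).hasFDerivAt
  have hG : ∀ i j, HasFDerivAt (fun z => metricCoeff g p z i j)
      (fderiv ℝ (fun z => metricCoeff g p z i j) y) y := fun i j =>
    (((contDiffOn_metricCoeff g p i j).contDiffAt hU).differentiableAt (by simp)).hasFDerivAt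
  have h1 : mvfderiv (𝓡 n) (fun x => g.inner x (Y x) (Z x)) ((extChartAt (𝓡 n) p).symm y)
      (X ((extChartAt (𝓡 n) p).symm y)) = ∑ i, ∑ j,
      (fderiv ℝ (fun z => metricCoeff g p z i j) y (coordField X p y)
          * coordField Y p y i * coordField Z p y j
        + metricCoeff g p y i j * fderiv ℝ (coordField Y p) y (coordField X p y) i
          * coordField Z p y j
        + metricCoeff g p y i j * coordField Y p y i
          * fderiv ℝ (coordField Z p) y (coordField X p y) j) := by
    rw [mvfderiv_eq_fderiv_comp X hy]
    · have he : (fun z => g.inner ((extChartAt (𝓡 n) p).symm z) (Y ((extChartAt (𝓡 n) p).symm z))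
          (Z ((extChartAt (𝓡 n) p).symm z))) =ᶠ[nhds y]
          fun z => ∑ i, ∑ j, metricCoeff g p z i j * coordField Y p z i * coordField Z p z j := by
        filter_upwards [hU] with z hz
        rw [← inner_mfderiv_eq_sum, mfderiv_coordField Y hz, mfderiv_coordField Z hz]
      rw [he.fderiv_eq, (HasFDerivAt.fun_sum fun i _ => HasFDerivAt.fun_sum fun j _ =>
        ((hG i j).fun_mul (hcomp hY i)).fun_mul (hcomp hZ j)).fderiv]
      simp only [_root_.sum_apply, _root_.add_apply, _root_.smul_apply, smul_eq_mul,
        ContinuousLinearMap.comp_apply, PiLp.proj_apply]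
      exact Finset.sum_congr rfl fun i _ => Finset.sum_congr rfl fun j _ => by ring
    · exact (contMDiffWithinAt_inner g (hY _).contMDiffWithinAt (hZ _).contMDiffWithinAt
        contMDiffWithinAt_id (s := Set.univ)).contMDiffAt Filter.univ_mem
        |>.mdifferentiableAt (by simp)
  rw [lieDerivMetric, h1, mlieBracket_eq_mfderiv_lieBracket hX hY hy,
    mlieBracket_eq_mfderiv_lieBracket hX hZ hy, ← mfderiv_coordField Y hy,
    ← mfderiv_coordField Z hy, inner_mfderiv_eq_sum, inner_mfderiv_eq_sum]
  simp only [← Finset.sum_sub_distrib]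
  refine Finset.sum_congr rfl fun i _ => Finset.sum_congr rfl fun j _ => ?_
  simp only [PiLp.sub_apply]
  ring

/-- A conformal vector field satisfies `div(√(det G) X) = n φ √(det G)` in coordinates. -/
theorem divergence_coordField
    (g : Bundle.ContMDiffRiemannianMetric (𝓡 n) ∞ (EuclideanSpace ℝ (Fin n))
      (fun x : M => TangentSpace (𝓡 n) x)) [T2Space M] {X : ∀ x : M, TangentSpace (𝓡 n) x}
    (hX : IsSmoothVectorField X) {φ : M → ℝ}
    (hφ : ∀ Y Z : ∀ x : M, TangentSpace (𝓡 n) x,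
      IsSmoothVectorField Y → IsSmoothVectorField Z → ∀ p : M,
        (1 / 2) * lieDerivMetric g X Y Z p = φ p * g.inner p (Y p) (Z p)) {p : M}
    {y : EuclideanSpace ℝ (Fin n)} (hy : y ∈ (extChartAt (𝓡 n) p).target) :
    fderiv ℝ (volumeDensity g p) y (coordField X p y) + volumeDensity g p y *
        ∑ k, fderiv ℝ (coordField X p) y (EuclideanSpace.single k 1) k
      = n * φ ((extChartAt (𝓡 n) p).symm y) * volumeDensity g p y := by
  have hU := (isOpen_extChartAt_target (I := 𝓡 n) p).mem_nhds hy
  refine fderiv_sqrt_det_of_conformal (fun i j =>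
    ((contDiffOn_metricCoeff g p i j).contDiffAt hU).differentiableAt (by simp))
    (det_metricCoeff_pos g hy) (coordField X p y)
    -- The Jacobian `Aᵢⱼ = ∂ⱼ Xⁱ`: in coordinates `𝓛_X g` is `X(G) + Aᵀ G + G A`, and `tr A` is the
    -- Euclidean divergence.
    (Matrix.of fun i j => fderiv ℝ (coordField X p) y (EuclideanSpace.single j 1) i) _ ?_
  have hex : ∀ v : EuclideanSpace ℝ (Fin n), ∃ Y : ∀ x : M, TangentSpace (𝓡 n) x,
      IsSmoothVectorField Y ∧ coordField Y p y = v := fun v => by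
    obtain ⟨Y, hY, hYv⟩ := exists_isSmoothVectorField_eq ((extChartAt (𝓡 n) p).symm y)
      (mfderiv 𝓘(ℝ, EuclideanSpace ℝ (Fin n)) (𝓡 n) (extChartAt (𝓡 n) p).symm y v)
    refine ⟨Y, hY, ?_⟩
    rw [← mfderiv_coordField Y hy] at hYv
    exact (isInvertible_mfderiv_extChartAt_symm hy).injective hYv
  -- Fields equal to basis vectors at `y` extract the `(a, b)` entry.
  ext a b
  obtain ⟨Y, hY, hYa⟩ := hex (EuclideanSpace.single a 1)
  obtain ⟨Z, hZ, hZb⟩ := hex (EuclideanSpace.single b 1)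
  have h := hφ Y Z hY hZ ((extChartAt (𝓡 n) p).symm y)
  rw [lieDerivMetric_eq_sum g hX hY hZ hy, ← mfderiv_coordField Y hy,
    ← mfderiv_coordField Z hy, inner_mfderiv_eq_sum, hYa, hZb] at h
  generalize φ ((extChartAt (𝓡 n) p).symm y) = c at h ⊢
  simp only [Matrix.add_apply, Matrix.mul_apply, Matrix.of_apply, Matrix.transpose_apply,
    Matrix.smul_apply, smul_eq_mul, mul_comm _ (metricCoeff g p y _ b)]
  simp [Finset.sum_add_distrib] at h
  linarith

/-! ### Integration in charts and change of chart -/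

/-- The integral of `h` with respect to the Riemannian volume over the domain of the preferred
chart around `p`. -/
noncomputable def chartIntegral
    (g : Bundle.ContMDiffRiemannianMetric (𝓡 n) ∞ (EuclideanSpace ℝ (Fin n))
      (fun x : M => TangentSpace (𝓡 n) x)) (p : M) (h : M → ℝ) : ℝ :=
  ∫ y in (extChartAt (𝓡 n) p).target, h ((extChartAt (𝓡 n) p).symm y) * volumeDensity g p y

theorem differentiableAt_transition {p q : M} {z : EuclideanSpace ℝ (Fin n)}
    (hz : z ∈ (extChartAt (𝓡 n) q).target)
    (hp : (extChartAt (𝓡 n) q).symm z ∈ (extChartAt (𝓡 n) p).source) :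
    DifferentiableAt ℝ (fun y => extChartAt (𝓡 n) p ((extChartAt (𝓡 n) q).symm y)) z := by
  rw [extChartAt_source] at hp
  exact ((contMDiffAt_extChartAt' (I := 𝓡 n) (n := ∞) hp).comp z
    (contMDiffAt_extChartAt_symm hz)).contDiffAt.differentiableAt (by simp)

/-- Near `z` the inverse chart at `q` is the inverse chart at `p` composed with `τ`, so the chain
rule applies to the coordinate frame. -/
theorem metricCoeff_transition
    (g : Bundle.ContMDiffRiemannianMetric (𝓡 n) ∞ (EuclideanSpace ℝ (Fin n))
      (fun x : M => TangentSpace (𝓡 n) x)) {p q : M} {z : EuclideanSpace ℝ (Fin n)}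
    (hz : z ∈ (extChartAt (𝓡 n) q).target)
    (hp : (extChartAt (𝓡 n) q).symm z ∈ (extChartAt (𝓡 n) p).source)
    {τ : EuclideanSpace ℝ (Fin n) → EuclideanSpace ℝ (Fin n)}
    (hτ : τ = fun y => extChartAt (𝓡 n) p ((extChartAt (𝓡 n) q).symm y))
    {T : Matrix (Fin n) (Fin n) ℝ}
    (hT : T = Matrix.of fun i j => fderiv ℝ τ z (EuclideanSpace.single j 1) i) :
    metricCoeff g q z = Tᵀ * metricCoeff g p (τ z) * T := by
  have hτz : τ z ∈ (extChartAt (𝓡 n) p).target := by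
    rw [hτ]; exact (extChartAt (𝓡 n) p).map_source hp
  have hev : (extChartAt (𝓡 n) q).symm =ᶠ[nhds z] (extChartAt (𝓡 n) p).symm ∘ τ := by
    have hc := (contMDiffAt_extChartAt_symm hz).continuousAt
    filter_upwards [hc.preimage_mem_nhds ((isOpen_extChartAt_source p).mem_nhds hp)] with y hy
    rw [hτ]
    exact ((extChartAt (𝓡 n) p).left_inv hy).symm
  have hdτ : DifferentiableAt ℝ τ z := hτ ▸ differentiableAt_transition hz hp
  have hd := hev.mfderiv_eq.trans (mfderiv_comp z
    ((contMDiffAt_extChartAt_symm hτz).mdifferentiableAt (by simp)) hdτ.mdifferentiableAt)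
  rw [mfderiv_eq_fderiv] at hd
  -- All tangent spaces are definitionally the model space; a non-dependent type lets the base point
  -- be rewritten.
  let B : M → EuclideanSpace ℝ (Fin n) →L[ℝ] EuclideanSpace ℝ (Fin n) →L[ℝ] ℝ := g.inner
  have hB : B ((extChartAt (𝓡 n) q).symm z) = B ((extChartAt (𝓡 n) p).symm (τ z)) :=
    congrArg B hev.self_of_nhds
  ext i j
  have h1 : metricCoeff g q z i j = B ((extChartAt (𝓡 n) p).symm (τ z))
      (mfderiv 𝓘(ℝ, EuclideanSpace ℝ (Fin n)) (𝓡 n) (extChartAt (𝓡 n) p).symm (τ z)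
        (fderiv ℝ τ z (EuclideanSpace.single i 1)))
      (mfderiv 𝓘(ℝ, EuclideanSpace ℝ (Fin n)) (𝓡 n) (extChartAt (𝓡 n) p).symm (τ z)
        (fderiv ℝ τ z (EuclideanSpace.single j 1))) := by
    rw [← hB]
    change B _ _ _ = _
    rw [hd]
    rfl
  have h2 := h1.trans (inner_mfderiv_eq_sum g p (τ z) _ _)
  rw [h2, Finset.sum_comm]
  simp only [hT, Matrix.mul_apply, Matrix.of_apply, Matrix.transpose_apply, Finset.sum_mul]
  exact Finset.sum_congr rfl fun k _ => Finset.sum_congr rfl fun l _ => by ring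

theorem volumeDensity_transition
    (g : Bundle.ContMDiffRiemannianMetric (𝓡 n) ∞ (EuclideanSpace ℝ (Fin n))
      (fun x : M => TangentSpace (𝓡 n) x)) {p q : M} {z : EuclideanSpace ℝ (Fin n)}
    (hz : z ∈ (extChartAt (𝓡 n) q).target)
    (hp : (extChartAt (𝓡 n) q).symm z ∈ (extChartAt (𝓡 n) p).source)
    {τ : EuclideanSpace ℝ (Fin n) → EuclideanSpace ℝ (Fin n)}
    (hτ : τ = fun y => extChartAt (𝓡 n) p ((extChartAt (𝓡 n) q).symm y)) :
    volumeDensity g q z = |(fderiv ℝ τ z).det| * volumeDensity g p (τ z) := by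
  have hdet : (Matrix.of fun i j => fderiv ℝ τ z (EuclideanSpace.single j 1) i).det
      = (fderiv ℝ τ z).det := by
    rw [ContinuousLinearMap.det, ← LinearMap.det_toMatrix
      (EuclideanSpace.basisFun (Fin n) ℝ).toBasis]
    congr 1
  rw [volumeDensity, metricCoeff_transition g hz hp hτ rfl, Matrix.det_mul, Matrix.det_mul,
    Matrix.det_transpose, hdet, mul_right_comm, Real.sqrt_mul (mul_self_nonneg _),
    Real.sqrt_mul_self_eq_abs, volumeDensity]

/-- Both integrals reduce to the overlap, where the change of variables produces exactly the factor
`|det Dτ|` relating the densities. -/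
theorem chartIntegral_eq_chartIntegral
    (g : Bundle.ContMDiffRiemannianMetric (𝓡 n) ∞ (EuclideanSpace ℝ (Fin n))
      (fun x : M => TangentSpace (𝓡 n) x)) {p q : M} {h : M → ℝ}
    (hp : ∀ x, x ∉ (extChartAt (𝓡 n) p).source → h x = 0)
    (hq : ∀ x, x ∉ (extChartAt (𝓡 n) q).source → h x = 0) :
    chartIntegral g p h = chartIntegral g q h := by
  set overlap : M → M → Set (EuclideanSpace ℝ (Fin n)) := fun p q =>
    (extChartAt (𝓡 n) p).target ∩ (extChartAt (𝓡 n) p).symm ⁻¹' (extChartAt (𝓡 n) q).source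
    with hov
  have hrestrict : ∀ p q : M, (∀ x, x ∉ (extChartAt (𝓡 n) q).source → h x = 0) →
      chartIntegral g p h = ∫ y in overlap p q,
        h ((extChartAt (𝓡 n) p).symm y) * volumeDensity g p y := fun p q hq =>
    setIntegral_eq_of_subset_of_forall_sdiff_eq_zero
      (isOpen_extChartAt_target p).measurableSet Set.inter_subset_left fun y hy => by
        rw [hq _ fun h' => hy.2 ⟨hy.1, h'⟩, zero_mul]
  have hmeas : MeasurableSet (overlap q p) :=
    ((continuousOn_extChartAt_symm q).isOpen_inter_preimage (isOpen_extChartAt_target q)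
      (isOpen_extChartAt_source p)).measurableSet
  set τ : EuclideanSpace ℝ (Fin n) → EuclideanSpace ℝ (Fin n) :=
    fun y => extChartAt (𝓡 n) p ((extChartAt (𝓡 n) q).symm y) with hτ
  have himage : τ '' overlap q p = overlap p q := by
    ext y
    constructor
    · rintro ⟨z, ⟨hz, hz'⟩, rfl⟩
      refine ⟨(extChartAt (𝓡 n) p).map_source hz', ?_⟩
      rw [Set.mem_preimage, hτ, (extChartAt (𝓡 n) p).left_inv hz']
      exact (extChartAt (𝓡 n) q).map_target hz
    · rintro ⟨hy, hy'⟩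
      refine ⟨extChartAt (𝓡 n) q ((extChartAt (𝓡 n) p).symm y),
        ⟨(extChartAt (𝓡 n) q).map_source hy', ?_⟩, ?_⟩
      · rw [Set.mem_preimage, (extChartAt (𝓡 n) q).left_inv hy']
        exact (extChartAt (𝓡 n) p).map_target hy
      · rw [hτ]
        simp only [(extChartAt (𝓡 n) q).left_inv hy', (extChartAt (𝓡 n) p).right_inv hy]
  have hinj : Set.InjOn τ (overlap q p) := fun y hy z hz hyz =>
    (extChartAt (𝓡 n) q).symm.injOn hy.1 hz.1 ((extChartAt (𝓡 n) p).injOn hy.2 hz.2 hyz)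
  rw [hrestrict p q hq, hrestrict q p hp, ← himage,
    integral_image_eq_integral_abs_det_fderiv_smul volume hmeas
      (fun z hz => (differentiableAt_transition hz.1 hz.2).hasFDerivAt.hasFDerivWithinAt) hinj]
  refine setIntegral_congr_fun hmeas fun z hz => ?_
  simp only [hτ, (extChartAt (𝓡 n) p).left_inv hz.2,
    volumeDensity_transition g hz.1 hz.2 hτ, smul_eq_mul]
  ring

/-- The image of `S` is compact in the chart target; the integrand is continuous there and zero
elsewhere. -/
theorem integrableOn_chart [CompactSpace M]
    (g : Bundle.ContMDiffRiemannianMetric (𝓡 n) ∞ (EuclideanSpace ℝ (Fin n))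
      (fun x : M => TangentSpace (𝓡 n) x)) {p : M} {h : M → ℝ} {S : Set M} (hS : IsClosed S)
    (hSp : S ⊆ (extChartAt (𝓡 n) p).source) (h0 : ∀ x, x ∉ S → h x = 0)
    (hc : ContinuousOn (fun y => h ((extChartAt (𝓡 n) p).symm y)) (extChartAt (𝓡 n) p).target) :
    IntegrableOn (fun y => h ((extChartAt (𝓡 n) p).symm y) * volumeDensity g p y)
      (extChartAt (𝓡 n) p).target := by
  have hK : IsCompact (extChartAt (𝓡 n) p '' S) :=
    hS.isCompact.image_of_continuousOn ((continuousOn_extChartAt p).mono hSp)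
  have hKU : extChartAt (𝓡 n) p '' S ⊆ (extChartAt (𝓡 n) p).target := by
    rintro _ ⟨x, hx, rfl⟩
    exact (extChartAt (𝓡 n) p).map_source (hSp hx)
  refine IntegrableOn.of_forall_sdiff_eq_zero (((hc.mul
    (contDiffOn_volumeDensity g p).continuousOn).mono hKU).integrableOn_compact hK)
    (isOpen_extChartAt_target p).measurableSet fun y hy => ?_
  rw [h0 _ fun hyS => hy.2 ⟨_, hyS, (extChartAt (𝓡 n) p).right_inv hy.1⟩, zero_mul]

/-- The integrand vanishes almost everywhere, hence by continuity everywhere on the open target, and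
the density is positive. -/
theorem eq_zero_of_chartIntegral_eq_zero
    (g : Bundle.ContMDiffRiemannianMetric (𝓡 n) ∞ (EuclideanSpace ℝ (Fin n))
      (fun x : M => TangentSpace (𝓡 n) x)) {p : M} {h : M → ℝ} (hpos : ∀ x, 0 ≤ h x)
    (hc : ContinuousOn (fun y => h ((extChartAt (𝓡 n) p).symm y)) (extChartAt (𝓡 n) p).target)
    (hi : IntegrableOn (fun y => h ((extChartAt (𝓡 n) p).symm y) * volumeDensity g p y)
      (extChartAt (𝓡 n) p).target)
    (h0 : chartIntegral g p h = 0) {x : M} (hx : x ∈ (extChartAt (𝓡 n) p).source) : h x = 0 := by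
  have hU := isOpen_extChartAt_target (I := 𝓡 n) p
  have hae := (setIntegral_eq_zero_iff_of_nonneg_ae
    ((ae_restrict_mem hU.measurableSet).mono fun y _ =>
      mul_nonneg (hpos _) (Real.sqrt_nonneg _)) hi).1 h0
  have heq := Measure.eqOn_open_of_ae_eq hae hU
    (hc.mul (contDiffOn_volumeDensity g p).continuousOn) continuousOn_const
    ((extChartAt (𝓡 n) p).map_source hx)
  have hw := (volumeDensity_pos g ((extChartAt (𝓡 n) p).map_source hx)).ne'
  have hw0 := (mul_eq_zero.1 heq).resolve_right hw
  rwa [(extChartAt (𝓡 n) p).left_inv hx] at hw0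

/-! ### Divergence theorem on the manifold by partition of unity -/

theorem contDiffOn_comp_extChartAt_symm {h : M → ℝ} (hh : ContMDiff (𝓡 n) 𝓘(ℝ) ∞ h) (p : M) :
    ContDiffOn ℝ ∞ (fun y => h ((extChartAt (𝓡 n) p).symm y)) (extChartAt (𝓡 n) p).target :=
  fun y hy => ((hh _).comp y (contMDiffAt_extChartAt_symm hy)).contDiffAt.contDiffWithinAt

theorem sum_mvfderiv_eq_zero {ι : Type*} [Fintype ι] {ρ : ι → M → ℝ}
    (hρ : ∀ i, ContMDiff (𝓡 n) 𝓘(ℝ) ∞ (ρ i)) (h1 : ∀ x, ∑ i, ρ i x = 1)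
    (X : ∀ x : M, TangentSpace (𝓡 n) x) (x : M) :
    ∑ i, mvfderiv (𝓡 n) (ρ i) x (X x) = 0 := by
  have hx := (mem_extChartAt_target (I := 𝓡 n) x)
  have hl : (extChartAt (𝓡 n) x).symm (extChartAt (𝓡 n) x x) = x := extChartAt_to_inv x
  have hd : ∀ i, DifferentiableAt ℝ (fun z => ρ i ((extChartAt (𝓡 n) x).symm z))
      (extChartAt (𝓡 n) x x) := fun i =>
    ((contDiffOn_comp_extChartAt_symm (hρ i) x).contDiffAt
      ((isOpen_extChartAt_target x).mem_nhds hx)).differentiableAt (by simp)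
  have h2 := fun i => mvfderiv_eq_fderiv_comp X hx ((hρ i).mdifferentiable (by simp) _)
  rw [hl] at h2
  simp only [h2]
  have h3 := fderiv_fun_sum (u := Finset.univ) fun i _ => hd i
  simp only [h1] at h3
  rw [← _root_.sum_apply, ← h3, fderiv_fun_const]
  rfl

theorem continuousOn_mvfderiv {X : ∀ x : M, TangentSpace (𝓡 n) x} (hX : IsSmoothVectorField X)
    {h : M → ℝ} (hh : ContMDiff (𝓡 n) 𝓘(ℝ) ∞ h) (p : M) :
    ContinuousOn (fun y => mvfderiv (𝓡 n) h ((extChartAt (𝓡 n) p).symm y)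
      (X ((extChartAt (𝓡 n) p).symm y))) (extChartAt (𝓡 n) p).target := by
  refine ContinuousOn.congr ?_ fun y hy =>
    mvfderiv_eq_fderiv_comp X hy (hh.mdifferentiable (by simp) _)
  exact ((contDiffOn_comp_extChartAt_symm hh p).continuousOn_fderiv_of_isOpen
    (isOpen_extChartAt_target p) (by simp)).clm_apply (contDiffOn_coordField hX p).continuousOn

/-- The divergence theorem for `h X`, with `X` conformal and `h` supported in a chart domain. -/
theorem chartIntegral_divergence_eq_zero [T2Space M] [CompactSpace M]
    (g : Bundle.ContMDiffRiemannianMetric (𝓡 n) ∞ (EuclideanSpace ℝ (Fin n))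
      (fun x : M => TangentSpace (𝓡 n) x)) {X : ∀ x : M, TangentSpace (𝓡 n) x}
    (hX : IsSmoothVectorField X) {φ : M → ℝ}
    (hφ : ∀ Y Z : ∀ x : M, TangentSpace (𝓡 n) x,
      IsSmoothVectorField Y → IsSmoothVectorField Z → ∀ p : M,
        (1 / 2) * lieDerivMetric g X Y Z p = φ p * g.inner p (Y p) (Z p)) {p : M}
    {h : M → ℝ} (hh : ContMDiff (𝓡 n) 𝓘(ℝ) ∞ h)
    (hp : tsupport h ⊆ (extChartAt (𝓡 n) p).source) :
    chartIntegral g p (fun x => n * φ x * h x + mvfderiv (𝓡 n) h x (X x)) = 0 := by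
  have hU := isOpen_extChartAt_target (I := 𝓡 n) p
  have hK : IsCompact (extChartAt (𝓡 n) p '' tsupport h) :=
    (isClosed_tsupport h).isCompact.image_of_continuousOn ((continuousOn_extChartAt p).mono hp)
  have hKU : extChartAt (𝓡 n) p '' tsupport h ⊆ (extChartAt (𝓡 n) p).target := by
    rintro _ ⟨x, hx, rfl⟩
    exact (extChartAt (𝓡 n) p).map_source (hp hx)
  have hh' := contDiffOn_comp_extChartAt_symm hh p
  have hw := contDiffOn_volumeDensity g p
  have hXc := contDiffOn_coordField hX p
  -- The zero on the right becomes the integral of the divergence of `h √(det G) X`; the two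
  -- integrands are then compared by the product rule.
  rw [← setIntegral_divergence_eq_zero hU hK hKU
    (V := fun y => (h ((extChartAt (𝓡 n) p).symm y) * volumeDensity g p y) • coordField X p y)
    (((hh'.mul hw).smul hXc).of_le (by simp)) fun y hy hyK => by
      rw [image_eq_zero_of_notMem_tsupport fun hy' =>
        hyK ⟨_, hy', (extChartAt (𝓡 n) p).right_inv hy⟩, zero_mul, zero_smul]]
  refine setIntegral_congr_fun hU.measurableSet fun y hy => ?_
  have hyU := hU.mem_nhds hy
  have hhd := ((hh'.contDiffAt hyU).differentiableAt (by simp)).hasFDerivAt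
  have hwd := ((hw.contDiffAt hyU).differentiableAt (by simp)).hasFDerivAt
  have hXd := ((hXc.contDiffAt hyU).differentiableAt (by simp)).hasFDerivAt
  have hsum : ∀ L : EuclideanSpace ℝ (Fin n) →L[ℝ] ℝ,
      ∑ k, L (EuclideanSpace.single k 1) * coordField X p y k = L (coordField X p y) := fun L => by
    have hv : ∑ k, coordField X p y k • EuclideanSpace.single k (1 : ℝ) = coordField X p y := by
      simpa using (EuclideanSpace.basisFun (Fin n) ℝ).sum_repr (coordField X p y)
    conv_rhs => rw [← hv, map_sum]
    exact Finset.sum_congr rfl fun k _ => by rw [map_smul, smul_eq_mul, mul_comm]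
  have hdiv := divergence_coordField g hX hφ hy
  simp only [mvfderiv_eq_fderiv_comp X hy (hh.mdifferentiable (by simp) _)]
  rw [((hhd.fun_mul hwd).fun_smul hXd).fderiv]
  simp only [_root_.add_apply, _root_.smul_apply, ContinuousLinearMap.smulRight_apply,
    PiLp.add_apply, PiLp.smul_apply, smul_eq_mul, Finset.sum_add_distrib, add_mul, mul_assoc,
    ← Finset.mul_sum, hsum]
  simp only [← mul_assoc] at hdiv ⊢
  linear_combination -(h ((extChartAt (𝓡 n) p).symm y)) * hdiv

theorem exists_finite_partitionOfUnity [T2Space M] [CompactSpace M] :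
    ∃ (t : Finset M) (ρ : t → M → ℝ), (∀ i, ContMDiff (𝓡 n) 𝓘(ℝ) ∞ (ρ i)) ∧
      (∀ i x, 0 ≤ ρ i x) ∧ (∀ x, ∑ i, ρ i x = 1) ∧
      ∀ i, tsupport (ρ i) ⊆ (extChartAt (𝓡 n) (i : M)).source := by
  obtain ⟨t, ht⟩ := isCompact_univ.elim_finite_subcover
    (fun p : M => (extChartAt (𝓡 n) p).source) (fun p => isOpen_extChartAt_source p)
    (fun x _ => Set.mem_iUnion.2 ⟨x, mem_extChartAt_source x⟩)
  obtain ⟨f, hf⟩ := SmoothPartitionOfUnity.exists_isSubordinate (𝓡 n) (s := Set.univ)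
    isClosed_univ (fun i : t => (extChartAt (𝓡 n) (i : M)).source)
    (fun i => isOpen_extChartAt_source _) (fun x hx => by simpa using ht hx)
  refine ⟨t, fun i => f i, fun i => (f i).contMDiff, fun i x => f.nonneg i x, fun x => ?_, hf⟩
  rw [← finsum_eq_sum_of_fintype]
  exact f.sum_eq_one (Set.mem_univ x)

/-- The conformal factor of a conformal vector field on a compact manifold vanishes identically if
it does not change sign. -/
theorem conformalFactor_eq_zero [T2Space M] [CompactSpace M] (hn : n ≠ 0)
    (g : Bundle.ContMDiffRiemannianMetric (𝓡 n) ∞ (EuclideanSpace ℝ (Fin n))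
      (fun x : M => TangentSpace (𝓡 n) x)) {X : ∀ x : M, TangentSpace (𝓡 n) x}
    (hX : IsSmoothVectorField X) {φ : M → ℝ}
    (hφ : ∀ Y Z : ∀ x : M, TangentSpace (𝓡 n) x,
      IsSmoothVectorField Y → IsSmoothVectorField Z → ∀ p : M,
        (1 / 2) * lieDerivMetric g X Y Z p = φ p * g.inner p (Y p) (Z p))
    (hsign : (∀ x, 0 ≤ φ x) ∨ ∀ x, φ x ≤ 0) (x : M) : φ x = 0 := by
  obtain ⟨t, ρ, hρ, hρ0, hρ1, hρs⟩ := exists_finite_partitionOfUnity (n := n) (M := M)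
  have hn' : (n : ℝ) ≠ 0 := Nat.cast_ne_zero.2 hn
  -- Nothing is assumed on the regularity of `φ`: its continuity comes from solving the divergence
  -- identity for it, as `n ≠ 0` and the density is positive.
  have hφc : ∀ p : M, ContinuousOn (fun y => φ ((extChartAt (𝓡 n) p).symm y))
      (extChartAt (𝓡 n) p).target := fun p => by
    have hw := contDiffOn_volumeDensity g p
    have hXc := contDiffOn_coordField hX p
    have hU := isOpen_extChartAt_target (I := 𝓡 n) p
    have hXd := hXc.continuousOn_fderiv_of_isOpen hU (by simp)
    have hc : ContinuousOn (fun y => (fderiv ℝ (volumeDensity g p) y (coordField X p y)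
        + volumeDensity g p y * ∑ k, fderiv ℝ (coordField X p) y (EuclideanSpace.single k 1) k)
        / (n * volumeDensity g p y)) (extChartAt (𝓡 n) p).target := by
      refine ContinuousOn.div (((hw.continuousOn_fderiv_of_isOpen hU (by simp)).clm_apply
        hXc.continuousOn).add (hw.continuousOn.mul (continuousOn_finsetSum _ fun k _ =>
          (EuclideanSpace.proj (𝕜 := ℝ) k).continuous.comp_continuousOn
            (hXd.clm_apply continuousOn_const)))) (continuousOn_const.mul hw.continuousOn)
        fun y hy => mul_ne_zero hn' (volumeDensity_pos g hy).ne'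
    refine hc.congr fun y hy => ?_
    beta_reduce
    rw [divergence_coordField g hX hφ hy, eq_div_iff
      (mul_ne_zero hn' (volumeDensity_pos g hy).ne')]
    ring
  have hρc : ∀ i p, ContinuousOn (fun y => ρ i ((extChartAt (𝓡 n) p).symm y))
      (extChartAt (𝓡 n) p).target := fun i p =>
    (contDiffOn_comp_extChartAt_symm (hρ i) p).continuousOn
  have hcont : ∀ i : t, ContinuousOn (fun y => n * φ ((extChartAt (𝓡 n) (i : M)).symm y)
      * ρ i ((extChartAt (𝓡 n) (i : M)).symm y)) (extChartAt (𝓡 n) (i : M)).target := fun i =>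
    (continuousOn_const.mul (hφc i)).mul (hρc i i)
  have hint : ∀ i : t, IntegrableOn (fun y => n * φ ((extChartAt (𝓡 n) (i : M)).symm y)
      * ρ i ((extChartAt (𝓡 n) (i : M)).symm y) * volumeDensity g i y)
      (extChartAt (𝓡 n) (i : M)).target := fun i =>
    integrableOn_chart g (h := fun x => n * φ x * ρ i x) (isClosed_tsupport (ρ i)) (hρs i)
      (fun x hx => by rw [image_eq_zero_of_notMem_tsupport hx, mul_zero]) (hcont i)
  have hXint : ∀ i : t, IntegrableOn (fun y => mvfderiv (𝓡 n) (ρ i) ((extChartAt (𝓡 n) (i : M)).symm y)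
      (X ((extChartAt (𝓡 n) (i : M)).symm y)) * volumeDensity g i y)
      (extChartAt (𝓡 n) (i : M)).target := fun i =>
    integrableOn_chart g (h := fun x => mvfderiv (𝓡 n) (ρ i) x (X x)) (isClosed_tsupport (ρ i))
      (hρs i) (fun x hx => mvfderiv_eq_zero_of_notMem_tsupport hx _)
      (continuousOn_mvfderiv hX (hρ i) i)
  have hdiv : ∀ i : t, chartIntegral g i (fun x => n * φ x * ρ i x)
      + chartIntegral g i (fun x => mvfderiv (𝓡 n) (ρ i) x (X x)) = 0 := fun i => by
    rw [← chartIntegral_divergence_eq_zero g hX hφ (hρ i) (hρs i), chartIntegral, chartIntegral,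
      chartIntegral, ← integral_add (hint i) (hXint i)]
    simp only [add_mul]
  -- In chart `i` the support of `X ρᵢ` controls the product, in chart `j` that of `ρⱼ`.
  have hprod : ∀ i j k : t, (k = i ∨ k = j) → IntegrableOn (fun y =>
      ρ j ((extChartAt (𝓡 n) (k : M)).symm y)
        * mvfderiv (𝓡 n) (ρ i) ((extChartAt (𝓡 n) (k : M)).symm y)
          (X ((extChartAt (𝓡 n) (k : M)).symm y)) * volumeDensity g k y)
      (extChartAt (𝓡 n) (k : M)).target := fun i j k hk => by
    have hc := (hρc j k).mul (continuousOn_mvfderiv hX (hρ i) k)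
    rcases hk with rfl | rfl
    · exact integrableOn_chart g (h := fun x => ρ j x * mvfderiv (𝓡 n) (ρ k) x (X x))
        (isClosed_tsupport (ρ k)) (hρs k)
        (fun x hx => by rw [mvfderiv_eq_zero_of_notMem_tsupport hx, mul_zero]) hc
    · exact integrableOn_chart g (h := fun x => ρ k x * mvfderiv (𝓡 n) (ρ i) x (X x))
        (isClosed_tsupport (ρ k)) (hρs k)
        (fun x hx => by rw [image_eq_zero_of_notMem_tsupport hx, zero_mul]) hc
  have hsplit : ∀ i : t, chartIntegral g i (fun x => mvfderiv (𝓡 n) (ρ i) x (X x))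
      = ∑ j, chartIntegral g i (fun x => ρ j x * mvfderiv (𝓡 n) (ρ i) x (X x)) := fun i => by
    simp only [chartIntegral]
    rw [← integral_finsetSum _ fun j _ => hprod i j i (Or.inl rfl)]
    simp only [← Finset.sum_mul, hρ1, one_mul]
  have hswap : ∀ i j : t, chartIntegral g i (fun x => ρ j x * mvfderiv (𝓡 n) (ρ i) x (X x))
      = chartIntegral g j (fun x => ρ j x * mvfderiv (𝓡 n) (ρ i) x (X x)) := fun i j =>
    chartIntegral_eq_chartIntegral g
      (fun x hx => by
        rw [mvfderiv_eq_zero_of_notMem_tsupport fun h => hx (hρs i h), mul_zero])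
      (fun x hx => by
        rw [image_eq_zero_of_notMem_tsupport fun h => hx (hρs j h), zero_mul])
  -- After the swap every summand with index `j` lives in chart `j`, so `∑ᵢ X ρᵢ = 0` can be used
  -- under the integral.
  have hXsum : ∑ i : t, chartIntegral g i (fun x => mvfderiv (𝓡 n) (ρ i) x (X x)) = 0 := by
    simp only [hsplit]
    rw [Finset.sum_congr rfl fun i _ => Finset.sum_congr rfl fun j _ => hswap i j,
      Finset.sum_comm]
    refine Finset.sum_eq_zero fun j _ => ?_
    simp only [chartIntegral]
    rw [← integral_finsetSum _ fun i _ => hprod i j j (Or.inr rfl)]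
    simp only [← Finset.sum_mul, ← Finset.mul_sum, sum_mvfderiv_eq_zero hρ hρ1, mul_zero,
      zero_mul, integral_zero]
  have hsum : ∑ i : t, chartIntegral g i (fun x => n * φ x * ρ i x) = 0 := by
    have := Finset.sum_eq_zero fun i (_ : i ∈ Finset.univ) => hdiv i
    rwa [Finset.sum_add_distrib, hXsum, add_zero] at this
  -- A vanishing sum of integrals of one sign forces each to vanish, hence each integrand; the
  -- nonpositive case is negated first.
  have hlocal : ∀ i : t, n * φ x * ρ i x = 0 := fun i => by
    by_cases hx : x ∈ (extChartAt (𝓡 n) (i : M)).source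
    swap
    · rw [image_eq_zero_of_notMem_tsupport fun h => hx (hρs i h), mul_zero]
    rcases hsign with hs | hs
    · have hnn : ∀ (i : t) x, 0 ≤ n * φ x * ρ i x := fun i x =>
        mul_nonneg (mul_nonneg n.cast_nonneg (hs x)) (hρ0 i x)
      have h0 := (Finset.sum_eq_zero_iff_of_nonneg fun i _ =>
        integral_nonneg fun y => mul_nonneg (hnn i _) (Real.sqrt_nonneg _)).1 hsum i
        (Finset.mem_univ i)
      exact eq_zero_of_chartIntegral_eq_zero g (hnn i) (hcont i) (hint i) h0 hx
    · have hnn : ∀ (i : t) x, 0 ≤ -(n * φ x * ρ i x) := fun i x => by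
        rw [neg_nonneg]
        exact mul_nonpos_of_nonpos_of_nonneg
          (mul_nonpos_of_nonneg_of_nonpos n.cast_nonneg (hs x)) (hρ0 i x)
      have hneg : ∀ i : t, chartIntegral g i (fun x => -(n * φ x * ρ i x))
          = -chartIntegral g i (fun x => n * φ x * ρ i x) := fun i => by
        simp only [chartIntegral, neg_mul, integral_neg]
      have hsum' : ∑ i : t, chartIntegral g i (fun x => -(n * φ x * ρ i x)) = 0 := by
        simp only [hneg, Finset.sum_neg_distrib, hsum, neg_zero]
      have h0 := (Finset.sum_eq_zero_iff_of_nonneg fun i _ =>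
        integral_nonneg fun y => mul_nonneg (hnn i _) (Real.sqrt_nonneg _)).1 hsum' i
        (Finset.mem_univ i)
      exact neg_eq_zero.1 (eq_zero_of_chartIntegral_eq_zero g (hnn i) (hcont i).neg
        ((hint i).neg.congr_fun (fun y _ => (neg_mul _ _).symm)
          (isOpen_extChartAt_target _).measurableSet) h0 hx)
  have := Finset.sum_eq_zero fun i (_ : i ∈ Finset.univ) => hlocal i
  rw [← Finset.mul_sum, hρ1, mul_one] at this
  exact (mul_eq_zero.1 this).resolve_left hn'

end AlmostYamabe

theorem mainTheorem2 {n : ℕ} (hn : 2 ≤ n) {M : Type*} [TopologicalSpace M] [T2Space M]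
    [CompactSpace M] [ChartedSpace (EuclideanSpace ℝ (Fin n)) M] [IsManifold (𝓡 n) ∞ M]
    (g : Bundle.ContMDiffRiemannianMetric (𝓡 n) ∞ (EuclideanSpace ℝ (Fin n))
      (fun x : M => TangentSpace (𝓡 n) x))
    (X : ∀ x : M, TangentSpace (𝓡 n) x) (ρ : M → ℝ)
    (hsol : AlmostYamabe.IsAlmostYamabeSoliton g X ρ)
    (hρ : (∀ p, 0 ≤ ρ p ∧ ρ p ≤ AlmostYamabe.scalarCurvature g p) ∨
      (∀ p, AlmostYamabe.scalarCurvature g p ≤ ρ p ∧ ρ p ≤ 0)) :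
    AlmostYamabe.IsKilling g X := by
  refine ⟨hsol.smooth_X, fun Y Z hY hZ p => ?_⟩
  have h := hsol.eqn Y Z hY hZ p
  rw [AlmostYamabe.conformalFactor_eq_zero (φ := fun p => AlmostYamabe.scalarCurvature g p - ρ p)
    (by omega) g hsol.smooth_X hsol.eqn (hρ.imp (fun h x => sub_nonneg.2 (h x).2)
      fun h x => sub_nonpos.2 (h x).1) p, zero_mul] at h
  linarith
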